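/- Let $\omega(t)=\sqrt{1-t^2}$ for $t\in(-1,1)$. For integers $m,k\ge 0$ let $$X_m^k=\{u\in L^2(-1,1)\;:\;\omega^{m+k}(\omega^{-m}u)^{(k)}\in L^2(-1,1)\},$$ where functions are real-valued and the $k$-th derivative is taken in the sense of distributions on $(-1,1)$, endowed with the norm $$\|u\|_{X_m^k}=\Big(\int_{-1}^1\omega^{2m+2k}\,\big|(\omega^{-m}u)^{(k)}\big|^2\,dt+\int_{-1}^1|u|^2\,dt\Big)^{1/2}.$$ Then for all integers $m,k\ge 0$ one has $X_{m+2}^k\subset X_m^k$ with continuous injection (the inclusion map $X_{m+2}^k\to X_m^k$ is continuous for these norms). Moreover, the inclusion is strict if $m<k$, that is, $X_{m+2}^k\subsetneq X_m^k$. -/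

import Mathlib

open MeasureTheory Set
open scoped ContDiff

noncomputable section

namespace WSob

/-- Lebesgue measure on the open interval `(-1,1)`. -/
abbrev mu : Measure ℝ := volume.restrict (Ioo (-1 : ℝ) 1)

/-- The real Hilbert space `L²(-1,1)`. -/
abbrev L2 : Type := Lp ℝ 2 mu

/-- The weight `ω(t) = √(1 - t²)`. -/
def omega (t : ℝ) : ℝ := Real.sqrt (1 - t ^ 2)

/-- `g` is the `k`-th derivative of `f` in the sense of distributions on `(-1,1)`, where `f` and `g`
are locally integrable on `(-1,1)`:
`∫ f φ⁽ᵏ⁾ = (-1)ᵏ ∫ g φ` for all smooth `φ` with compact support contained in `(-1,1)`. -/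
structure HasWeakDeriv (k : ℕ) (f g : ℝ → ℝ) : Prop where
  locInt_left : LocallyIntegrableOn f (Ioo (-1 : ℝ) 1)
  locInt_right : LocallyIntegrableOn g (Ioo (-1 : ℝ) 1)
  integral_eq : ∀ φ : ℝ → ℝ, ContDiff ℝ ∞ φ → HasCompactSupport φ → tsupport φ ⊆ Ioo (-1 : ℝ) 1 →
    ∫ t in Ioo (-1 : ℝ) 1, f t * iteratedDeriv k φ t
      = (-1 : ℝ) ^ k * ∫ t in Ioo (-1 : ℝ) 1, g t * φ t

/-- `w = (ω⁻ᵐ u)⁽ᵏ⁾` as distributions on `(-1,1)`, and `ωᵐ⁺ᵏ w ∈ L²(-1,1)`. -/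
structure IsWDeriv (m k : ℕ) (u w : ℝ → ℝ) : Prop where
  weak : HasWeakDeriv k (fun t => omega t ^ (-(m : ℤ)) * u t) w
  memLp : MemLp (fun t => omega t ^ (m + k) * w t) 2 mu

/-! ### Elementary facts on weak derivatives -/

lemma omega_pos {t : ℝ} (ht : t ∈ Ioo (-1 : ℝ) 1) : 0 < omega t := by
  apply Real.sqrt_pos.2
  nlinarith [ht.1, ht.2]

lemma tsupport_iteratedDeriv_subset (k : ℕ) (φ : ℝ → ℝ) :
    tsupport (iteratedDeriv k φ) ⊆ tsupport φ := by
  induction k with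
  | zero => simp
  | succ k ih =>
    rw [iteratedDeriv_succ]
    exact (closure_minimal (support_deriv_subset) (isClosed_tsupport _)).trans ih

lemma integrable_mul_test {f ψ : ℝ → ℝ} (hf : LocallyIntegrableOn f (Ioo (-1 : ℝ) 1))
    (hψ : Continuous ψ) (hc : HasCompactSupport ψ) (hs : tsupport ψ ⊆ Ioo (-1 : ℝ) 1) :
    IntegrableOn (fun t => f t * ψ t) (Ioo (-1 : ℝ) 1) := by
  have h1 : IntegrableOn f (tsupport ψ) := hf.integrableOn_compact_subset hs hc
  have h2 : IntegrableOn (fun t => f t * ψ t) (tsupport ψ) :=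
    h1.mul_continuousOn hψ.continuousOn hc
  have h3 : Integrable (fun t => f t * ψ t) := by
    refine (integrableOn_iff_integrable_of_support_subset ?_).1 h2
    intro t ht
    apply subset_tsupport
    simp only [Function.mem_support] at ht ⊢
    exact right_ne_zero_of_mul ht
  exact h3.integrableOn

lemma HasWeakDeriv.add {k : ℕ} {f g f' g' : ℝ → ℝ} (h : HasWeakDeriv k f g)
    (h' : HasWeakDeriv k f' g') :
    HasWeakDeriv k (fun t => f t + f' t) (fun t => g t + g' t) where
  locInt_left := h.locInt_left.add h'.locInt_left
  locInt_right := h.locInt_right.add h'.locInt_right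
  integral_eq φ h1 h2 h3 := by
    have hc : Continuous (iteratedDeriv k φ) :=
      h1.continuous_iteratedDeriv k (by exact_mod_cast le_top)
    have hs := tsupport_iteratedDeriv_subset k φ
    have hcs : HasCompactSupport (iteratedDeriv k φ) :=
      h2.of_isClosed_subset (isClosed_tsupport _) hs
    simp only [add_mul]
    rw [integral_add (integrable_mul_test h.locInt_left hc hcs (hs.trans h3))
        (integrable_mul_test h'.locInt_left hc hcs (hs.trans h3)),
      integral_add (integrable_mul_test h.locInt_right h1.continuous h2 h3)
        (integrable_mul_test h'.locInt_right h1.continuous h2 h3),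
      h.integral_eq φ h1 h2 h3, h'.integral_eq φ h1 h2 h3, mul_add]

lemma HasWeakDeriv.const_mul {k : ℕ} {f g : ℝ → ℝ} (h : HasWeakDeriv k f g) (c : ℝ) :
    HasWeakDeriv k (fun t => c * f t) (fun t => c * g t) where
  locInt_left := h.locInt_left.smul c
  locInt_right := h.locInt_right.smul c
  integral_eq φ h1 h2 h3 := by
    simp only [mul_assoc]
    rw [integral_const_mul, integral_const_mul, h.integral_eq φ h1 h2 h3]
    ring

lemma HasWeakDeriv.congr_left {k : ℕ} {f f' g : ℝ → ℝ} (h : HasWeakDeriv k f g)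
    (hf : f =ᵐ[mu] f') : HasWeakDeriv k f' g where
  locInt_left := LocallyIntegrableOn.congr hf h.locInt_left
  locInt_right := h.locInt_right
  integral_eq φ h1 h2 h3 := by
    rw [← h.integral_eq φ h1 h2 h3]
    apply integral_congr_ae
    filter_upwards [hf] with t ht
    rw [ht]

/-- Weak derivatives are unique up to null sets. -/
lemma HasWeakDeriv.unique {k : ℕ} {f g g' : ℝ → ℝ} (h : HasWeakDeriv k f g)
    (h' : HasWeakDeriv k f g') : g =ᵐ[mu] g' := by
  have hl : LocallyIntegrableOn (fun t => g t - g' t) (Ioo (-1 : ℝ) 1) :=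
    h.locInt_right.sub h'.locInt_right
  have key := isOpen_Ioo.ae_eq_zero_of_integral_contDiff_smul_eq_zero hl (by
    intro φ h1 h2 h3
    have e : ∫ t in Ioo (-1 : ℝ) 1, g t * φ t = ∫ t in Ioo (-1 : ℝ) 1, g' t * φ t := by
      have := (h.integral_eq φ h1 h2 h3).symm.trans (h'.integral_eq φ h1 h2 h3)
      exact mul_left_cancel₀ (pow_ne_zero k (by norm_num)) this
    have hz : ∀ t, t ∉ Ioo (-1 : ℝ) 1 → φ t • (g t - g' t) = 0 := by
      intro t ht
      rw [image_eq_zero_of_notMem_tsupport (fun hh => ht (h3 hh)), zero_smul]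
    rw [← setIntegral_eq_integral_of_forall_compl_eq_zero hz]
    have : (fun t => φ t • (g t - g' t)) = fun t => g t * φ t - g' t * φ t := by
      funext t; simp only [smul_eq_mul]; ring
    rw [this, integral_sub (integrable_mul_test h.locInt_right h1.continuous h2 h3)
      (integrable_mul_test h'.locInt_right h1.continuous h2 h3), e, sub_self])
  rw [Filter.EventuallyEq, ae_restrict_iff' measurableSet_Ioo]
  filter_upwards [key] with t ht hm
  exact sub_eq_zero.1 (ht hm)

lemma HasWeakDeriv.zero (k : ℕ) : HasWeakDeriv k (fun _ => 0) (fun _ => 0) where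
  locInt_left := (locallyIntegrable_zero).locallyIntegrableOn _
  locInt_right := (locallyIntegrable_zero).locallyIntegrableOn _
  integral_eq φ _ _ _ := by simp

lemma IsWDeriv.congr {m k : ℕ} {u u' w : ℝ → ℝ} (h : IsWDeriv m k u w) (hu : u =ᵐ[mu] u') :
    IsWDeriv m k u' w :=
  ⟨h.weak.congr_left (by filter_upwards [hu] with t ht; rw [ht]), h.memLp⟩

lemma IsWDeriv.add {m k : ℕ} {u w u' w' : ℝ → ℝ} (h : IsWDeriv m k u w)
    (h' : IsWDeriv m k u' w') :
    IsWDeriv m k (fun t => u t + u' t) (fun t => w t + w' t) :=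
  ⟨by simpa only [mul_add] using h.weak.add h'.weak,
   by simpa only [mul_add] using! h.memLp.add h'.memLp⟩

lemma IsWDeriv.const_mul {m k : ℕ} {u w : ℝ → ℝ} (h : IsWDeriv m k u w) (c : ℝ) :
    IsWDeriv m k (fun t => c * u t) (fun t => c * w t) :=
  ⟨by simpa only [mul_left_comm] using h.weak.const_mul c,
   by simpa only [mul_left_comm] using! h.memLp.const_mul c⟩

/-! ### The weighted Sobolev spaces -/

/-- The set `Xₘᵏ = {u ∈ L²(-1,1) : ωᵐ⁺ᵏ (ω⁻ᵐ u)⁽ᵏ⁾ ∈ L²(-1,1)}`, as a linear subspace of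
`L²(-1,1)`. -/
def XSub (m k : ℕ) : Submodule ℝ L2 where
  carrier := {u | ∃ w : ℝ → ℝ, IsWDeriv m k u w}
  zero_mem' := by
    refine ⟨fun _ => 0, IsWDeriv.congr (u := fun _ => 0) ⟨?_, ?_⟩ ?_⟩
    · simpa using HasWeakDeriv.zero k
    · simp
    · exact (Lp.coeFn_zero ℝ 2 mu).symm
  add_mem' := by
    rintro u v ⟨w, hw⟩ ⟨w', hw'⟩
    exact ⟨_, (hw.add hw').congr (Lp.coeFn_add u v).symm⟩
  smul_mem' := by
    rintro c u ⟨w, hw⟩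
    exact ⟨_, (hw.const_mul c).congr (Lp.coeFn_smul c u).symm⟩

/-- The space `Xₘᵏ` as a type of its own; it carries its own norm (below), not the `L²` norm. -/
def X (m k : ℕ) : Type := ↥(XSub m k)

variable {m k : ℕ}

instance : AddCommGroup (X m k) := inferInstanceAs (AddCommGroup ↥(XSub m k))

instance : Module ℝ (X m k) := inferInstanceAs (Module ℝ ↥(XSub m k))

/-- The element of `L²(-1,1)` underlying `u ∈ Xₘᵏ`. -/
def X.toL2 : X m k →ₗ[ℝ] L2 := (XSub m k).subtype

lemma X.toL2_mem (u : X m k) : X.toL2 u ∈ XSub m k := u.property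

lemma X.toL2_injective : Function.Injective (X.toL2 : X m k →ₗ[ℝ] L2) :=
  Subtype.val_injective

/-- The distributional derivative `(ω⁻ᵐ u)⁽ᵏ⁾` of `u ∈ Xₘᵏ`. -/
def X.deriv (u : X m k) : ℝ → ℝ := Classical.choose (X.toL2_mem u)

lemma X.isWDeriv (u : X m k) : IsWDeriv m k (X.toL2 u) u.deriv :=
  Classical.choose_spec (X.toL2_mem u)

lemma X.deriv_ae_eq (u : X m k) {w : ℝ → ℝ} (hw : IsWDeriv m k (X.toL2 u) w) :
    u.deriv =ᵐ[mu] w :=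
  u.isWDeriv.weak.unique hw.weak

/-- The linear map `u ↦ ωᵐ⁺ᵏ (ω⁻ᵐ u)⁽ᵏ⁾` from `Xₘᵏ` to `L²(-1,1)`. -/
def X.weightedDeriv : X m k →ₗ[ℝ] L2 where
  toFun u := u.isWDeriv.memLp.toLp _
  map_add' u v := by
    rw [← MemLp.toLp_add]
    apply MemLp.toLp_congr
    have := (u + v).deriv_ae_eq ((u.isWDeriv.add v.isWDeriv).congr
      ((Lp.coeFn_add (X.toL2 u) (X.toL2 v)).symm.trans (by rw [map_add])))
    filter_upwards [this] with t ht
    simp only [Pi.add_apply]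
    rw [ht, mul_add]
  map_smul' c u := by
    rw [RingHom.id_apply, ← MemLp.toLp_const_smul]
    apply MemLp.toLp_congr
    have := (c • u).deriv_ae_eq ((u.isWDeriv.const_mul c).congr
      ((Lp.coeFn_smul c (X.toL2 u)).symm.trans (by rw [map_smul])))
    filter_upwards [this] with t ht
    simp only [Pi.smul_apply, smul_eq_mul]
    rw [ht, mul_left_comm]

/-- The map `u ↦ (ωᵐ⁺ᵏ (ω⁻ᵐ u)⁽ᵏ⁾, u)` into the Hilbert sum `L²(-1,1) ⊕ L²(-1,1)`. -/
def X.graph : X m k →ₗ[ℝ] WithLp 2 (L2 × L2) :=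
  (WithLp.linearEquiv 2 ℝ (L2 × L2)).symm.toLinearMap ∘ₗ (X.weightedDeriv.prod X.toL2)

lemma X.graph_injective : Function.Injective (X.graph : X m k →ₗ[ℝ] WithLp 2 (L2 × L2)) := by
  intro u v h
  have h2 := congrArg (fun z => (WithLp.ofLp z).2) h
  exact X.toL2_injective h2

/-- The natural norm of `Xₘᵏ`, `‖u‖² = ‖ωᵐ⁺ᵏ (ω⁻ᵐ u)⁽ᵏ⁾‖² + ‖u‖²` with norms of `L²(-1,1)` on the
right (spelled out with integrals in `X.norm_eq`). -/
instance : NormedAddCommGroup (X m k) :=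
  NormedAddCommGroup.induced (X m k) (WithLp 2 (L2 × L2)) X.graph X.graph_injective

instance : NormedSpace ℝ (X m k) :=
  NormedSpace.induced ℝ (X m k) (WithLp 2 (L2 × L2)) X.graph

lemma norm_L2_sq (f : L2) : ‖f‖ ^ 2 = ∫ t in Ioo (-1 : ℝ) 1, |f t| ^ 2 := by
  have := L2.inner_def (𝕜 := ℝ) f f
  rw [real_inner_self_eq_norm_sq] at this
  rw [this]
  apply integral_congr_ae
  filter_upwards with t
  simp [sq]

/-- The norm of `Xₘᵏ`, where `w` is the distributional derivative `(ω⁻ᵐ u)⁽ᵏ⁾`. -/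
theorem X.norm_eq (u : X m k) {w : ℝ → ℝ} (hw : IsWDeriv m k (X.toL2 u) w) :
    ‖u‖ = Real.sqrt ((∫ t in Ioo (-1 : ℝ) 1, omega t ^ (2 * m + 2 * k) * |w t| ^ 2)
      + ∫ t in Ioo (-1 : ℝ) 1, |X.toL2 u t| ^ 2) := by
  have h1 : ‖u‖ = ‖X.graph u‖ := rfl
  rw [h1, WithLp.prod_norm_eq_of_L2]
  have h2 : (X.graph u).fst = X.weightedDeriv u := rfl
  have h3 : (X.graph u).snd = X.toL2 u := rfl
  rw [h2, h3, norm_L2_sq, norm_L2_sq]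
  congr 2
  apply integral_congr_ae
  have h4 : X.weightedDeriv u =ᵐ[mu] fun t => omega t ^ (m + k) * u.deriv t :=
    MemLp.coeFn_toLp u.isWDeriv.memLp
  filter_upwards [h4, u.deriv_ae_eq hw] with t ht ht'
  rw [ht, ht', sq_abs, sq_abs]
  ring

/-- The inclusion map `Xₘᵏ → X_{m'}^{k'}`, `u ↦ u`, when `Xₘᵏ ⊆ X_{m'}^{k'}`. -/
def X.incl {m' k' : ℕ} (h : XSub m k ≤ XSub m' k') : X m k →ₗ[ℝ] X m' k' :=
  Submodule.inclusion h

end WSob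

end

namespace WSob

/-! ### Calculus of weak derivatives -/

/-! Put `g = ω^{-(m+2)} u`, so that `ω^{-m} u = (1 - t²) g`. Since `1 - t²` is quadratic, the
Leibniz formula has only three terms: `((1 - t²) g)^{(k)} = (1 - t²) g^{(k)} - 2kt g^{(k-1)} -
k(k-1) g^{(k-2)}`. After multiplication by `ω^{m+k}` the first term is `ω^{m+2+k} g^{(k)}`, which is
in `L²` by hypothesis. The other two are controlled by a Hardy inequality (`memLp_of_primitive`): if
`ω^{a+2} h'` is in `L²`, so is `ω^a h`.

Only the derivative of order `k` is given as a function. `HasWeakDeriv.exists_chain` recovers the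
lower ones as iterated primitives, by a du Bois-Reymond argument; this justifies the Leibniz formula
and supplies the primitives to which Hardy applies.

Continuity needs no explicit estimate. Each space is complete, because its graph in `L² ⊕ L²` is cut
out by continuous linear equations, and it injects continuously into `L²`; the closed graph theorem
then applies.

For strictness take `u = ω^m (1 + t)`. Then `ω^{-m} u = 1 + t` is a polynomial, while `ω^{-(m+2)} u
= 1/(1 - t)`, and the square of its weighted `k`-th derivative behaves like `(1 - t)^{m-k}` near
`1`, which is not integrable when `m < k`. -/

lemma exists_Ioo_of_isCompact {K : Set ℝ} (hK : IsCompact K) (hs : K ⊆ Ioo (-1 : ℝ) 1) :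
    ∃ r ∈ Ioo (0 : ℝ) 1, K ⊆ Ioo (-r) r := by
  rcases K.eq_empty_or_nonempty with rfl | hne
  · exact ⟨1 / 2, by norm_num, empty_subset _⟩
  obtain ⟨x, hx, hmax⟩ := hK.exists_isMaxOn hne (continuous_abs (G := ℝ)).continuousOn
  have hx1 : |x| < 1 := abs_lt.2 (hs hx)
  refine ⟨(1 + |x|) / 2, ⟨by positivity, by linarith⟩, fun y hy => abs_lt.1 ?_⟩
  have : |y| ≤ |x| := hmax hy
  linarith

lemma uIcc_subset_Ioo {a b : ℝ} (ha : a ∈ Ioo (-1 : ℝ) 1) (hb : b ∈ Ioo (-1 : ℝ) 1) :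
    uIcc a b ⊆ Ioo (-1 : ℝ) 1 :=
  ordConnected_Ioo.uIcc_subset ha hb

lemma intervalIntegrable_of_locInt {w : ℝ → ℝ} (hw : LocallyIntegrableOn w (Ioo (-1 : ℝ) 1))
    {a b : ℝ} (ha : a ∈ Ioo (-1 : ℝ) 1) (hb : b ∈ Ioo (-1 : ℝ) 1) :
    IntervalIntegrable w volume a b :=
  (hw.integrableOn_compact_subset (uIcc_subset_Ioo ha hb) isCompact_uIcc).intervalIntegrable

lemma setIntegral_eq_intervalIntegral {F : ℝ → ℝ} {r : ℝ} (hr : r ∈ Ioo (0 : ℝ) 1)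
    (hF : ∀ t, t ∉ Ioo (-r) r → F t = 0) :
    ∫ t in Ioo (-1 : ℝ) 1, F t = ∫ t in (-r)..r, F t := by
  rw [intervalIntegral.integral_of_le (by linarith [hr.1]), integral_Ioc_eq_integral_Ioo]
  apply setIntegral_eq_of_subset_of_forall_sdiff_eq_zero measurableSet_Ioo
  · exact Ioo_subset_Ioo (by linarith [hr.2]) hr.2.le
  · exact fun t ht => hF t ht.2

lemma continuousOn_of_primitive {w W : ℝ → ℝ} {c : ℝ}
    (hw : LocallyIntegrableOn w (Ioo (-1 : ℝ) 1))
    (hW : ∀ t ∈ Ioo (-1 : ℝ) 1, W t = c + ∫ s in (0 : ℝ)..t, w s) :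
    ContinuousOn W (Ioo (-1 : ℝ) 1) := by
  refine ContinuousOn.congr (f := fun t => c + ∫ s in (0 : ℝ)..t, w s) ?_ hW
  refine continuousOn_const.add fun x hx => ContinuousAt.continuousWithinAt ?_
  obtain ⟨r, hr, hxr⟩ := exists_Ioo_of_isCompact (K := {x}) isCompact_singleton (by simpa using hx)
  have hrl : -r ∈ Ioo (-1 : ℝ) 1 := ⟨by linarith [hr.2], by linarith [hr.1]⟩
  have hrr : r ∈ Ioo (-1 : ℝ) 1 := ⟨by linarith [hr.1], hr.2⟩
  have hle : -r ≤ r := by linarith [hr.1]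
  have h := intervalIntegral.continuousOn_primitive_interval' (a := 0)
    (intervalIntegrable_of_locInt hw hrl hrr)
    (by rw [uIcc_of_le hle]; exact ⟨by linarith [hr.1], hr.1.le⟩)
  rw [uIcc_of_le hle] at h
  have hx' : x ∈ Ioo (-r) r := hxr rfl
  exact h.continuousAt (Icc_mem_nhds hx'.1 hx'.2)

/-- A primitive of a locally integrable function has that function as its weak derivative. -/
lemma hasWeakDeriv_one_of_primitive {w W : ℝ → ℝ} {c : ℝ}
    (hw : LocallyIntegrableOn w (Ioo (-1 : ℝ) 1))
    (hW : ∀ t ∈ Ioo (-1 : ℝ) 1, W t = c + ∫ s in (0 : ℝ)..t, w s) :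
    HasWeakDeriv 1 W w where
  locInt_left := (continuousOn_of_primitive hw hW).locallyIntegrableOn measurableSet_Ioo
  locInt_right := hw
  integral_eq φ h1 h2 h3 := by
    obtain ⟨r, hr, hφ⟩ := exists_Ioo_of_isCompact h2 h3
    have hle : -r ≤ r := by linarith [hr.1]
    have hrl : -r ∈ Ioo (-1 : ℝ) 1 := ⟨by linarith [hr.2], by linarith [hr.1]⟩
    have hrr : r ∈ Ioo (-1 : ℝ) 1 := ⟨by linarith [hr.1], hr.2⟩
    have hz : ∀ t, t ∉ Ioo (-r) r → φ t = 0 := fun t ht =>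
      image_eq_zero_of_notMem_tsupport fun h => ht (hφ h)
    have hz' : ∀ t, t ∉ Ioo (-r) r → deriv φ t = 0 := fun t ht =>
      image_eq_zero_of_notMem_tsupport fun h =>
        ht (hφ (closure_minimal support_deriv_subset (isClosed_tsupport _) h))
    have hint := intervalIntegrable_of_locInt hw hrl hrr
    have h0 : (0 : ℝ) ∈ uIcc (-r) r := by
      rw [uIcc_of_le hle]; exact ⟨by linarith [hr.1], hr.1.le⟩
    have hac : AbsolutelyContinuousOnInterval (fun t => ∫ s in (0 : ℝ)..t, w s) (-r) r :=
      hint.absolutelyContinuousOnInterval_intervalIntegral h0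
    have hφac : AbsolutelyContinuousOnInterval φ (-r) r :=
      (h1.of_le (by exact_mod_cast le_top)).contDiffOn.absolutelyContinuousOnInterval
    -- Integration by parts for absolutely continuous functions; the boundary terms vanish because
    -- `φ (±r) = 0`. The constant `c` drops out because `∫ φ' = 0`.
    have key := hac.integral_mul_deriv_eq_deriv_mul hφac
    rw [hz r (by simp), hz (-r) (by simp)] at key
    have hφint : ∫ t in (-r)..r, deriv φ t = 0 := by
      rw [hφac.integral_deriv_eq_sub, hz r (by simp), hz (-r) (by simp), sub_zero]
    have hd : Continuous (deriv φ) := h1.continuous_deriv (by exact_mod_cast le_top)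
    rw [iteratedDeriv_one,
      setIntegral_eq_intervalIntegral hr (fun t ht => by rw [hz' t ht, mul_zero]),
      setIntegral_eq_intervalIntegral hr (fun t ht => by rw [hz t ht, mul_zero])]
    have e1 : ∫ t in (-r)..r, W t * deriv φ t
        = ∫ t in (-r)..r, (c * deriv φ t + (∫ s in (0 : ℝ)..t, w s) * deriv φ t) := by
      apply intervalIntegral.integral_congr
      intro t ht
      have ht' : t ∈ Ioo (-1 : ℝ) 1 := uIcc_subset_Ioo hrl hrr ht
      simp only [hW t ht', add_mul]
    have e2 : ∫ t in (-r)..r, deriv (fun t => ∫ s in (0 : ℝ)..t, w s) t * φ t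
        = ∫ t in (-r)..r, w t * φ t := by
      apply intervalIntegral.integral_congr_ae
      filter_upwards [hint.ae_hasDerivAt_integral] with t ht ht'
      rw [(ht (uIoc_subset_uIcc ht') 0 h0).deriv]
    rw [e1, intervalIntegral.integral_add ((hd.intervalIntegrable _ _).const_mul c)
      ((hd.intervalIntegrable _ _).continuousOn_mul hac.continuousOn),
      intervalIntegral.integral_const_mul, hφint, key, e2]
    ring

lemma contDiff_iteratedDeriv {φ : ℝ → ℝ} (h : ContDiff ℝ ∞ φ) (k : ℕ) :
    ContDiff ℝ ∞ (iteratedDeriv k φ) := by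
  rw [iteratedDeriv_eq_iterate]
  exact h.iterate_deriv k

lemma HasWeakDeriv.trans {j l : ℕ} {f g h : ℝ → ℝ} (h1 : HasWeakDeriv j f g)
    (h2 : HasWeakDeriv l g h) : HasWeakDeriv (j + l) f h where
  locInt_left := h1.locInt_left
  locInt_right := h2.locInt_right
  integral_eq φ hφ hc hs := by
    have hsub := tsupport_iteratedDeriv_subset l φ
    have e : iteratedDeriv (j + l) φ = iteratedDeriv j (iteratedDeriv l φ) := by
      simp only [iteratedDeriv_eq_iterate, Function.iterate_add, Function.comp_apply]
    rw [e, h1.integral_eq _ (contDiff_iteratedDeriv hφ l)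
      (hc.of_isClosed_subset (isClosed_tsupport _) hsub) (hsub.trans hs),
      h2.integral_eq φ hφ hc hs, pow_add, mul_assoc]

lemma HasWeakDeriv.refl {f : ℝ → ℝ} (hf : LocallyIntegrableOn f (Ioo (-1 : ℝ) 1)) :
    HasWeakDeriv 0 f f where
  locInt_left := hf
  locInt_right := hf
  integral_eq φ _ _ _ := by simp

lemma HasWeakDeriv.ae_eq {f g : ℝ → ℝ} (h : HasWeakDeriv 0 f g) : f =ᵐ[mu] g :=
  (HasWeakDeriv.refl h.locInt_left).unique h

lemma locInt_mul_continuous {f p : ℝ → ℝ} (hf : LocallyIntegrableOn f (Ioo (-1 : ℝ) 1))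
    (hp : ContinuousOn p (Ioo (-1 : ℝ) 1)) :
    LocallyIntegrableOn (fun t => p t * f t) (Ioo (-1 : ℝ) 1) := by
  rw [locallyIntegrableOn_iff isOpen_Ioo.isLocallyClosed] at hf ⊢
  intro K hK hc
  exact (hf K hK hc).continuousOn_mul (hp.mono hK) hc

/-- The product rule for a smooth function and a weakly differentiable function. -/
lemma HasWeakDeriv.smooth_mul {f g p : ℝ → ℝ} (h : HasWeakDeriv 1 f g) (hp : ContDiff ℝ ∞ p) :
    HasWeakDeriv 1 (fun t => p t * f t) (fun t => deriv p t * f t + p t * g t) where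
  locInt_left := locInt_mul_continuous h.locInt_left hp.continuous.continuousOn
  locInt_right := (locInt_mul_continuous h.locInt_left
    (hp.continuous_deriv (by exact_mod_cast le_top)).continuousOn).add
    (locInt_mul_continuous h.locInt_right hp.continuous.continuousOn)
  integral_eq φ h1 h2 h3 := by
    have hdp : Continuous (deriv p) := hp.continuous_deriv (by exact_mod_cast le_top)
    have hsub : tsupport (fun t => p t * φ t) ⊆ tsupport φ := tsupport_mul_subset_right
    have hc : HasCompactSupport (fun t => p t * φ t) := h2.mul_left
    have hsub' : tsupport (fun t => deriv p t * φ t) ⊆ tsupport φ := tsupport_mul_subset_right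
    have hc' : HasCompactSupport (fun t => deriv p t * φ t) := h2.mul_left
    have hpφ : ContDiff ℝ ∞ (fun t => p t * φ t) := hp.mul h1
    have hd : ∀ t, deriv (fun t => p t * φ t) t = deriv p t * φ t + p t * deriv φ t := fun t =>
      ((hp.differentiable (by simp) t).hasDerivAt.mul
        (h1.differentiable (by simp) t).hasDerivAt).deriv
    have key := h.integral_eq _ hpφ hc (hsub.trans h3)
    rw [iteratedDeriv_one] at key ⊢
    have i1 := integrable_mul_test h.locInt_left
      (hpφ.continuous_deriv (by exact_mod_cast le_top)) hc.deriv
      ((closure_minimal support_deriv_subset (isClosed_tsupport _)).trans (hsub.trans h3))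
    have i2 : IntegrableOn (fun t => f t * (deriv p t * φ t)) (Ioo (-1 : ℝ) 1) :=
      integrable_mul_test h.locInt_left (hdp.mul h1.continuous) hc' (hsub'.trans h3)
    have i3 := integrable_mul_test h.locInt_right hpφ.continuous hc (hsub.trans h3)
    have e1 : ∀ t, p t * f t * deriv φ t
        = f t * deriv (fun t => p t * φ t) t - f t * (deriv p t * φ t) := fun t => by
      rw [hd]; ring
    have e2 : ∀ t, (deriv p t * f t + p t * g t) * φ t
        = f t * (deriv p t * φ t) + g t * (p t * φ t) := fun t => by ring
    simp only [e1, e2]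
    rw [integral_sub i1 i2, integral_add i2 i3, key]
    ring

lemma exists_test_integral_one : ∃ η : ℝ → ℝ, ContDiff ℝ ∞ η ∧ HasCompactSupport η ∧
    tsupport η ⊆ Ioo (-1 : ℝ) 1 ∧ ∫ t in Ioo (-1 : ℝ) 1, η t = 1 := by
  let b : ContDiffBump (0 : ℝ) := ⟨1 / 4, 1 / 2, by norm_num, by norm_num⟩
  have hs : tsupport (b.normed volume) ⊆ Ioo (-1 : ℝ) 1 := by
    rw [b.tsupport_normed_eq, Real.closedBall_eq_Icc]
    intro t ht
    have h1 : (0 : ℝ) - 1 / 2 ≤ t := ht.1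
    have h2 : t ≤ (0 : ℝ) + 1 / 2 := ht.2
    exact ⟨by linarith, by linarith⟩
  refine ⟨b.normed volume, b.contDiff_normed, b.hasCompactSupport_normed, hs, ?_⟩
  rw [setIntegral_eq_integral_of_forall_compl_eq_zero
    (fun t ht => image_eq_zero_of_notMem_tsupport fun h => ht (hs h))]
  exact b.integral_normed

/-- A test function with vanishing integral is the derivative of a test function. -/
lemma exists_test_primitive {θ : ℝ → ℝ} (h1 : ContDiff ℝ ∞ θ) (h2 : HasCompactSupport θ)
    (h3 : tsupport θ ⊆ Ioo (-1 : ℝ) 1) (h0 : ∫ t in Ioo (-1 : ℝ) 1, θ t = 0) :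
    ∃ Θ : ℝ → ℝ, ContDiff ℝ ∞ Θ ∧ HasCompactSupport Θ ∧ tsupport Θ ⊆ Ioo (-1 : ℝ) 1 ∧
      deriv Θ = θ := by
  obtain ⟨r, hr, hθ⟩ := exists_Ioo_of_isCompact h2 h3
  have hz : ∀ t, t ∉ Ioo (-r) r → θ t = 0 := fun t ht =>
    image_eq_zero_of_notMem_tsupport fun h => ht (hθ h)
  rw [setIntegral_eq_intervalIntegral hr hz] at h0
  have hder : ∀ t, HasDerivAt (fun t => ∫ s in (-r)..t, θ s) (θ t) t := fun t =>
    (h1.continuous.integral_hasStrictDerivAt _ _).hasDerivAt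
  have hd : deriv (fun t => ∫ s in (-r)..t, θ s) = θ := funext fun t => (hder t).deriv
  have hsupp : tsupport (fun t => ∫ s in (-r)..t, θ s) ⊆ Icc (-r) r := by
    refine closure_minimal (fun t ht => ?_) isClosed_Icc
    by_contra hn
    apply ht
    rcases lt_or_ge t (-r) with h | h
    · refine (intervalIntegral.integral_congr (g := fun _ => 0) fun s hs => hz s fun hh => ?_).trans
        (by simp)
      rw [uIcc_of_ge h.le] at hs
      exact absurd hh.1 (not_lt.2 hs.2)
    · have hr' : r ≤ t := by
        by_contra hlt
        exact hn ⟨h, (not_le.1 hlt).le⟩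
      change ∫ s in (-r)..t, θ s = 0
      rw [← intervalIntegral.integral_add_adjacent_intervals
        (h1.continuous.intervalIntegrable _ r) (h1.continuous.intervalIntegrable _ _), h0, zero_add]
      refine (intervalIntegral.integral_congr (g := fun _ => 0) fun s hs => hz s fun hh => ?_).trans
        (by simp)
      rw [uIcc_of_le hr'] at hs
      exact absurd hh.2 (not_lt.2 hs.1)
  refine ⟨_, ?_, isCompact_Icc.of_isClosed_subset (isClosed_tsupport _) hsupp,
    hsupp.trans (Icc_subset_Ioo (by linarith [hr.2]) hr.2), hd⟩
  rw [contDiff_infty_iff_deriv, hd]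
  exact ⟨fun t => (hder t).differentiableAt, h1⟩

/-- A weak derivative of order `k + 1` is the derivative of a weak derivative of order `k`, which
can be taken to be a primitive. -/
lemma HasWeakDeriv.exists_primitive {k : ℕ} {f w : ℝ → ℝ} (h : HasWeakDeriv (k + 1) f w) :
    ∃ c : ℝ, HasWeakDeriv k f (fun t => c + ∫ s in (0 : ℝ)..t, w s) := by
  obtain ⟨η, hη1, hη2, hη3, hη4⟩ := exists_test_integral_one
  set W : ℝ → ℝ := fun t => 0 + ∫ s in (0 : ℝ)..t, w s with hWdef
  have hW : HasWeakDeriv 1 W w := hasWeakDeriv_one_of_primitive h.locInt_right fun _ _ => rfl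
  -- This value makes the desired identity hold for the single test function `η`. Any other `φ` is
  -- `(∫ φ) η` plus a test function of integral zero, hence plus some `Θ'`, and for `Θ'` the
  -- identity follows by testing both `f` and `W` against `Θ`.
  set C : ℝ := (-1) ^ k * (∫ t in Ioo (-1 : ℝ) 1, f t * iteratedDeriv k η t)
    - ∫ t in Ioo (-1 : ℝ) 1, W t * η t with hC
  have hcW : HasWeakDeriv 1 (fun t => C + ∫ s in (0 : ℝ)..t, w s) w :=
    hasWeakDeriv_one_of_primitive h.locInt_right fun _ _ => rfl
  refine ⟨C, h.locInt_left, hcW.locInt_left, fun φ h1 h2 h3 => ?_⟩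
  set I : ℝ := ∫ t in Ioo (-1 : ℝ) 1, φ t with hI
  have iφ : IntegrableOn φ (Ioo (-1 : ℝ) 1) :=
    (h1.continuous.integrable_of_hasCompactSupport h2).integrableOn
  have iη : IntegrableOn η (Ioo (-1 : ℝ) 1) :=
    (hη1.continuous.integrable_of_hasCompactSupport hη2).integrableOn
  have hIη : ContDiff ℝ ∞ (fun t => I * η t) := contDiff_const.mul hη1
  have hsIη : tsupport (fun t => I * η t) ⊆ tsupport η := tsupport_mul_subset_right
  have hsub : tsupport (fun t => φ t - I * η t) ⊆ Ioo (-1 : ℝ) 1 :=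
    (tsupport_sub φ (fun t => I * η t)).trans (union_subset h3 (hsIη.trans hη3))
  obtain ⟨Θ, hΘ1, hΘ2, hΘ3, hΘ4⟩ := exists_test_primitive (θ := fun t => φ t - I * η t)
    (h1.sub hIη) (h2.sub hη2.mul_left) hsub (by
      rw [integral_sub iφ (iη.const_mul I), integral_const_mul, hη4, mul_one, sub_self])
  have k1 := h.integral_eq Θ hΘ1 hΘ2 hΘ3
  have k2 := hW.integral_eq Θ hΘ1 hΘ2 hΘ3
  rw [iteratedDeriv_succ', hΘ4] at k1
  rw [iteratedDeriv_one, hΘ4] at k2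
  have hder : ∀ t, iteratedDeriv k (fun t => φ t - I * η t) t
      = iteratedDeriv k φ t - I * iteratedDeriv k η t := fun t => by
    have hk : ((k : ℕ∞) : WithTop ℕ∞) ≤ ∞ := by exact_mod_cast le_top
    rw [iteratedDeriv_fun_sub (h1.of_le hk).contDiffAt (hIη.of_le hk).contDiffAt,
      iteratedDeriv_const_mul_field]
  have cφ := (contDiff_iteratedDeriv h1 k).continuous
  have cη := (contDiff_iteratedDeriv hη1 k).continuous
  have sφ := tsupport_iteratedDeriv_subset k φ
  have sη := tsupport_iteratedDeriv_subset k η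
  have i1 := integrable_mul_test h.locInt_left cφ
    (h2.of_isClosed_subset (isClosed_tsupport _) sφ) (sφ.trans h3)
  have i2 := integrable_mul_test h.locInt_left cη
    (hη2.of_isClosed_subset (isClosed_tsupport _) sη) (sη.trans hη3)
  have i3 := integrable_mul_test hW.locInt_left h1.continuous h2 h3
  have i4 := integrable_mul_test hW.locInt_left hη1.continuous hη2 hη3
  have e1 : ∫ t in Ioo (-1 : ℝ) 1, f t * iteratedDeriv k (fun t => φ t - I * η t) t
      = (∫ t in Ioo (-1 : ℝ) 1, f t * iteratedDeriv k φ t)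
        - I * ∫ t in Ioo (-1 : ℝ) 1, f t * iteratedDeriv k η t := by
    rw [← integral_const_mul, ← integral_sub i1 (i2.const_mul I)]
    congr 1; funext t; rw [hder]; ring
  have e2 : ∫ t in Ioo (-1 : ℝ) 1, W t * (φ t - I * η t)
      = (∫ t in Ioo (-1 : ℝ) 1, W t * φ t) - I * ∫ t in Ioo (-1 : ℝ) 1, W t * η t := by
    rw [← integral_const_mul, ← integral_sub i3 (i4.const_mul I)]
    congr 1; funext t; ring
  have e3 : ∫ t in Ioo (-1 : ℝ) 1, (C + ∫ s in (0 : ℝ)..t, w s) * φ t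
      = C * I + ∫ t in Ioo (-1 : ℝ) 1, W t * φ t := by
    rw [hI, ← integral_const_mul, ← integral_add (iφ.const_mul C) i3]
    congr 1; funext t; simp only [hWdef]; ring
  have hsq : ((-1 : ℝ) ^ k) * (-1) ^ k = 1 := by rw [← mul_pow]; simp
  rw [e1] at k1
  rw [e2] at k2
  rw [e3, hC]
  rw [pow_succ] at k1
  linear_combination k1 - (-1 : ℝ) ^ k * k2
    - I * (∫ t in Ioo (-1 : ℝ) 1, f t * iteratedDeriv k η t) * hsq

/-- A function with a `k`-th weak derivative agrees almost everywhere with an iterated primitive. -/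
lemma HasWeakDeriv.exists_chain {k : ℕ} {f w : ℝ → ℝ} (h : HasWeakDeriv k f w) :
    ∃ g : ℕ → ℝ → ℝ, f =ᵐ[mu] g 0 ∧ g k = w ∧ ∀ j < k, HasWeakDeriv 1 (g j) (g (j + 1)) ∧
      ∃ c : ℝ, ∀ t ∈ Ioo (-1 : ℝ) 1, g j t = c + ∫ s in (0 : ℝ)..t, g (j + 1) s := by
  induction k generalizing w with
  | zero => exact ⟨fun _ => w, h.ae_eq, rfl, by simp⟩
  | succ k ih =>
    obtain ⟨c, hc⟩ := h.exists_primitive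
    obtain ⟨g, hg0, hgk, hg⟩ := ih hc
    -- The chain obtained by induction ends at a primitive of `w`; `w` itself is appended at index
    -- `k + 1`.
    refine ⟨fun j => if j ≤ k then g j else w, by simpa using hg0, by simp, fun j hj => ?_⟩
    have hjk : j ≤ k := Nat.lt_succ_iff.1 hj
    simp only [hjk, if_true]
    rcases hjk.lt_or_eq with hlt | rfl
    · simpa only [Nat.succ_le_of_lt hlt, if_true] using hg j hlt
    · simp only [Nat.not_succ_le_self, if_false, hgk]
      exact ⟨hasWeakDeriv_one_of_primitive h.locInt_right fun _ _ => rfl, c, fun _ _ => rfl⟩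

/-- The `n`-th derivative of `(1 - t²) g₀`, where `gⱼ₊₁` is the derivative of `gⱼ`. -/
def leibniz (g : ℕ → ℝ → ℝ) (n : ℕ) (t : ℝ) : ℝ :=
  (1 - t ^ 2) * g n t + -2 * n * t * g (n - 1) t + -(n * (n - 1)) * g (n - 2) t

/-- Induction on `n`, applying the product rule to each of the three terms. The truncated indices `n
- 1` and `n - 2` are harmless: wherever truncation occurs, the coefficient `n` or `n (n - 1)` is
zero. -/
lemma hasWeakDeriv_leibniz {g : ℕ → ℝ → ℝ} {k : ℕ}
    (h0 : LocallyIntegrableOn (g 0) (Ioo (-1 : ℝ) 1))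
    (hg : ∀ j < k, HasWeakDeriv 1 (g j) (g (j + 1))) (n : ℕ) (hn : n ≤ k) :
    HasWeakDeriv n (fun t => (1 - t ^ 2) * g 0 t) (leibniz g n) := by
  have hp : ContDiff ℝ ∞ (fun t : ℝ => 1 - t ^ 2) := by fun_prop
  have hdp : deriv (fun t : ℝ => 1 - t ^ 2) = fun t => -2 * t := by
    funext t
    simp
  induction n with
  | zero =>
    have e : leibniz g 0 = fun t => (1 - t ^ 2) * g 0 t := by funext t; simp [leibniz]
    rw [e]
    exact HasWeakDeriv.refl (locInt_mul_continuous h0 hp.continuous.continuousOn)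
  | succ n ih =>
    refine (ih (by omega)).trans ?_
    have d1 := (hg n (by omega)).smooth_mul hp
    rw [hdp] at d1
    -- For `n = 0` the index `n - 1` is truncated, so `g (n - 1)` does not differentiate to `g n`;
    -- this case is done by hand. The same happens for `g (m - 1)` at `m = 0` below.
    rcases n with _ | m
    · have e : leibniz g 0 = fun t => (1 - t ^ 2) * g 0 t := by funext t; simp [leibniz]
      have e' : leibniz g (0 + 1) = fun t => -2 * t * g 0 t + (1 - t ^ 2) * g (0 + 1) t := by
        funext t; simp [leibniz]; ring
      rw [e, e']
      exact d1
    · have hq : ContDiff ℝ ∞ (fun t : ℝ => -2 * ((m + 1 : ℕ) : ℝ) * t) := by fun_prop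
      have hdq : deriv (fun t : ℝ => -2 * ((m + 1 : ℕ) : ℝ) * t)
          = fun _ => -2 * ((m + 1 : ℕ) : ℝ) := by
        funext t
        simp
      have d2 := (hg m (by omega)).smooth_mul hq
      rw [hdq] at d2
      have d3 : HasWeakDeriv 1 (fun t => -((m + 1 : ℝ) * m) * g (m - 1) t)
          (fun t => -((m + 1 : ℝ) * m) * g m t) := by
        rcases m with _ | m
        · simp [HasWeakDeriv.zero 1]
        · exact (hg m (by omega)).const_mul _
      have d := (d1.add d2).add d3
      have e : leibniz g (m + 1) = fun t => (1 - t ^ 2) * g (m + 1) t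
          + -2 * ((m + 1 : ℕ) : ℝ) * t * g m t + -((m + 1 : ℝ) * m) * g (m - 1) t := by
        funext t
        have : m + 1 - 2 = m - 1 := by omega
        simp [leibniz, this]
      rw [e]
      convert d using 1
      funext t
      have : m + 1 + 1 - 2 = m := by omega
      simp only [leibniz, this, Nat.add_sub_cancel]
      push_cast
      ring

/-! ### Hardy's inequality -/

open scoped ENNReal

lemma continuous_omega : Continuous omega := by
  unfold omega; fun_prop

lemma omega_sq {t : ℝ} (ht : t ∈ Ioo (-1 : ℝ) 1) : omega t ^ 2 = 1 - t ^ 2 :=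
  Real.sq_sqrt (by nlinarith [ht.1, ht.2])

lemma omega_le_one (t : ℝ) : omega t ≤ 1 :=
  Real.sqrt_le_one.2 (by nlinarith [sq_nonneg t])

lemma omega_nonneg (t : ℝ) : 0 ≤ omega t := Real.sqrt_nonneg _

lemma omega_neg (t : ℝ) : omega (-t) = omega t := by simp [omega]

lemma omega_le_omega {s t : ℝ} (hs : 0 ≤ s) (hst : s ≤ t) : omega t ≤ omega s :=
  Real.sqrt_le_sqrt (by nlinarith)

/-- A nonnegative derivative is automatically integrable, so the fundamental theorem survives a
blow-up of `f` at an endpoint, as for `ω⁻¹` at `1`. -/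
lemma lintegral_Ioo_ofReal_deriv {F f : ℝ → ℝ} {a b : ℝ} (hab : a ≤ b)
    (hc : ContinuousOn F (Icc a b)) (hd : ∀ x ∈ Ioo a b, HasDerivAt F (f x) x)
    (hf : ∀ x ∈ Ioo a b, 0 ≤ f x) :
    ∫⁻ x in Ioo a b, ENNReal.ofReal (f x) = ENNReal.ofReal (F b - F a) := by
  have hi : IntegrableOn f (Ioc a b) := intervalIntegral.integrableOn_deriv_of_nonneg hc hd hf
  rw [← intervalIntegral.integral_eq_sub_of_hasDerivAt_of_le hab hc hd
    ((intervalIntegrable_iff_integrableOn_Ioc_of_le hab).2 hi),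
    intervalIntegral.integral_of_le hab, integral_Ioc_eq_integral_Ioo,
    ofReal_integral_eq_lintegral_ofReal (hi.mono_set Ioo_subset_Ioc_self)]
  filter_upwards [ae_restrict_mem measurableSet_Ioo] with x hx using hf x hx

/-- The function `s / ω(s)` is a primitive of `ω⁻³`, and `t ≤ 1`. -/
lemma lintegral_omega_inv_cube {t : ℝ} (ht : t ∈ Ioo (0 : ℝ) 1) :
    ∫⁻ s in Ioo 0 t, ENNReal.ofReal ((omega s ^ 3)⁻¹) ≤ ENNReal.ofReal (omega t)⁻¹ := by
  have hd : ∀ s ∈ Icc 0 t, HasDerivAt (fun s => s / omega s) ((omega s ^ 3)⁻¹) s := by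
    intro s hs
    have hs' : s ∈ Ioo (-1 : ℝ) 1 := ⟨by linarith [hs.1], by linarith [hs.2, ht.2]⟩
    have hpos := omega_pos hs'
    have hsq := omega_sq hs'
    have h1 : HasDerivAt (fun s : ℝ => 1 - s ^ 2) (-(2 * s)) s := by
      simpa using (hasDerivAt_pow 2 s).const_sub 1
    have h2 : HasDerivAt omega (-(2 * s) / (2 * omega s)) s :=
      h1.sqrt (by rw [← hsq]; positivity)
    have e : (omega s ^ 3)⁻¹ = (1 * omega s - s * (-(2 * s) / (2 * omega s))) / omega s ^ 2 := by
      field_simp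
      linarith
    rw [e]
    exact (hasDerivAt_id s).div h2 hpos.ne'
  rw [lintegral_Ioo_ofReal_deriv ht.1.le (fun s hs => (hd s hs).continuousAt.continuousWithinAt)
    (fun s hs => hd s (Ioo_subset_Icc_self hs)) (fun s _ => by have := omega_nonneg s; positivity)]
  apply ENNReal.ofReal_le_ofReal
  have hpos := omega_pos (t := t) ⟨by linarith [ht.1], ht.2⟩
  rw [zero_div, sub_zero, div_eq_mul_inv]
  exact mul_le_of_le_one_left (by positivity) ht.2.le

lemma lintegral_omega_inv {s : ℝ} (hs : s ∈ Ioo (0 : ℝ) 1) :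
    ∫⁻ t in Ioo s 1, ENNReal.ofReal (omega t)⁻¹ ≤ 2 * ENNReal.ofReal (omega s) := by
  rw [lintegral_Ioo_ofReal_deriv (F := Real.arcsin) hs.2.le Real.continuous_arcsin.continuousOn
    (fun t ht => ?_) (fun t _ => inv_nonneg.2 (omega_nonneg t))]
  · have h2 : (2 : ℝ≥0∞) = ENNReal.ofReal 2 := by simp
    rw [h2, ← ENNReal.ofReal_mul (by norm_num)]
    apply ENNReal.ofReal_le_ofReal
    have e : Real.arcsin 1 - Real.arcsin s = Real.arccos s := by
      rw [Real.arcsin_one, Real.arccos]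
    -- The integral is `arccos s`, and `sin (arccos s) = ω(s)`. Jordan's inequality gives `arccos s
    -- ≤ (π / 2) ω(s)`, and `π ≤ 4` yields the constant `2`.
    have h := Real.mul_le_sin (Real.arccos_nonneg s) (Real.arccos_le_pi_div_two.2 hs.1.le)
    rw [Real.sin_arccos] at h
    change _ ≤ omega s at h
    rw [e]
    have hpi := Real.pi_pos
    have hpi4 := Real.pi_le_four
    have h' : 2 * Real.arccos s ≤ Real.pi * omega s := by
      rw [div_mul_eq_mul_div, div_le_iff₀ hpi] at h
      linarith
    nlinarith [omega_nonneg s]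
  · have := Real.hasDerivAt_arcsin (x := t) (by linarith [ht.1, hs.1]) ht.2.ne
    simpa [omega, one_div] using this

/-- Cauchy-Schwarz with the weight `ω⁻¹`. -/
lemma sq_lintegral_le {v : ℝ → ℝ≥0∞} (hv : Measurable v) {t : ℝ} (ht : t ∈ Ioo (0 : ℝ) 1) :
    (∫⁻ s in Ioo 0 t, v s * ENNReal.ofReal ((omega s ^ 2)⁻¹)) ^ 2
      ≤ (∫⁻ s in Ioo 0 t, v s ^ 2 * ENNReal.ofReal (omega s)⁻¹) * ENNReal.ofReal (omega t)⁻¹ := by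
  have hm : ∀ n : ℕ, Measurable fun s => ENNReal.ofReal ((omega s ^ n)⁻¹) := fun n =>
    ((continuous_omega.measurable.pow_const n).inv).ennreal_ofReal
  have hm1 : Measurable fun s => ENNReal.ofReal (omega s)⁻¹ := by simpa using hm 1
  -- The splitting is `v ω⁻² = (v ω^{-1/2}) (ω^{-3/2})`: the second factor squared has an explicit
  -- primitive, and the first leaves the weight `ω⁻¹`, still integrable up to `1`.
  have key := ENNReal.lintegral_mul_norm_pow_le (μ := volume.restrict (Ioo 0 t))
    (f := fun s => v s ^ 2 * ENNReal.ofReal (omega s)⁻¹)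
    (g := fun s => ENNReal.ofReal ((omega s ^ 3)⁻¹))
    ((hv.pow_const 2).mul hm1).aemeasurable (hm 3).aemeasurable
    (p := 1 / 2) (q := 1 / 2) (by norm_num) (by norm_num) (by norm_num)
  have e : ∫⁻ s in Ioo 0 t, v s * ENNReal.ofReal ((omega s ^ 2)⁻¹)
      = ∫⁻ s in Ioo 0 t, (v s ^ 2 * ENNReal.ofReal (omega s)⁻¹) ^ (1 / 2 : ℝ)
        * ENNReal.ofReal ((omega s ^ 3)⁻¹) ^ (1 / 2 : ℝ) := by
    apply lintegral_congr
    intro s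
    have h0 := omega_nonneg s
    rw [← ENNReal.mul_rpow_of_nonneg _ _ (by norm_num), mul_assoc,
      ← ENNReal.ofReal_mul (by positivity)]
    have e1 : (omega s)⁻¹ * (omega s ^ 3)⁻¹ = ((omega s ^ 2)⁻¹) ^ 2 := by
      rw [← mul_inv, ← inv_pow]; ring
    rw [e1, ENNReal.ofReal_pow (by positivity), ← mul_pow, ← ENNReal.rpow_natCast,
      ← ENNReal.rpow_mul]
    norm_num
  have hsq : ∀ x : ℝ≥0∞, (x ^ (1 / 2 : ℝ)) ^ 2 = x := fun x => by
    rw [← ENNReal.rpow_natCast, ← ENNReal.rpow_mul]; norm_num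
  rw [e]
  calc _ ≤ _ := pow_le_pow_left' key 2
    _ = _ := by rw [mul_pow, hsq, hsq]
    _ ≤ _ := by gcongr; exact lintegral_omega_inv_cube ht

/-- After Cauchy-Schwarz, Tonelli on the triangle `s < t` leaves `∫_s^1 ω⁻¹ ≤ 2 ω(s)`, which cancels
the remaining `ω(s)⁻¹`. -/
lemma lintegral_hardy_of_measurable {v : ℝ → ℝ≥0∞} (hv : Measurable v) :
    ∫⁻ t in Ioo (0 : ℝ) 1, (∫⁻ s in Ioo 0 t, v s * ENNReal.ofReal ((omega s ^ 2)⁻¹)) ^ 2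
      ≤ 2 * ∫⁻ s in Ioo (0 : ℝ) 1, v s ^ 2 := by
  set ρ : ℝ → ℝ≥0∞ := fun s => ENNReal.ofReal (omega s)⁻¹ with hρ
  have hρm : Measurable ρ := (continuous_omega.measurable.inv).ennreal_ofReal
  have hfm : Measurable fun s => v s ^ 2 * ρ s := (hv.pow_const 2).mul hρm
  calc
    _ ≤ ∫⁻ t in Ioo (0 : ℝ) 1, (∫⁻ s in Ioo 0 t, v s ^ 2 * ρ s) * ρ t :=
      setLIntegral_mono' measurableSet_Ioo fun t ht => sq_lintegral_le hv ht
    _ = ∫⁻ t in Ioo (0 : ℝ) 1, ∫⁻ s in Ioo (0 : ℝ) 1, if s < t then v s ^ 2 * ρ s * ρ t else 0 := by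
      refine setLIntegral_congr_fun measurableSet_Ioo fun t ht => ?_
      have e : Ioo 0 t = Iio t ∩ Ioo (0 : ℝ) 1 := by
        ext s; exact ⟨fun h => ⟨h.2, h.1, h.2.trans ht.2⟩, fun h => ⟨h.2.1, h.1⟩⟩
      rw [← lintegral_mul_const _ hfm, e, ← Measure.restrict_restrict measurableSet_Iio,
        ← lintegral_indicator measurableSet_Iio]
      rfl
    _ = ∫⁻ s in Ioo (0 : ℝ) 1, ∫⁻ t in Ioo (0 : ℝ) 1, if s < t then v s ^ 2 * ρ s * ρ t else 0 := by
      apply lintegral_lintegral_swap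
      apply Measurable.aemeasurable
      exact Measurable.ite (measurableSet_lt measurable_snd measurable_fst)
        ((hfm.comp measurable_snd).mul (hρm.comp measurable_fst)) measurable_const
    _ = ∫⁻ s in Ioo (0 : ℝ) 1, v s ^ 2 * ρ s * ∫⁻ t in Ioo s 1, ρ t := by
      refine setLIntegral_congr_fun measurableSet_Ioo fun s hs => ?_
      have e : Ioo s 1 = Ioi s ∩ Ioo (0 : ℝ) 1 := by
        ext t; exact ⟨fun h => ⟨h.1, hs.1.trans h.1, h.2⟩, fun h => ⟨h.1, h.2.2⟩⟩
      rw [← lintegral_const_mul _ hρm, e, ← Measure.restrict_restrict measurableSet_Ioi,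
        ← lintegral_indicator measurableSet_Ioi]
      rfl
    _ ≤ ∫⁻ s in Ioo (0 : ℝ) 1, 2 * v s ^ 2 := by
      refine setLIntegral_mono' measurableSet_Ioo fun s hs => ?_
      have hpos := omega_pos (t := s) ⟨by linarith [hs.1], hs.2⟩
      calc _ ≤ v s ^ 2 * ρ s * (2 * ENNReal.ofReal (omega s)) := by
            gcongr; exact lintegral_omega_inv hs
        _ = 2 * v s ^ 2 * (ρ s * ENNReal.ofReal (omega s)) := by ring
        _ = _ := by
          rw [hρ, ← ENNReal.ofReal_mul (inv_nonneg.2 hpos.le), inv_mul_cancel₀ hpos.ne',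
            ENNReal.ofReal_one, mul_one]
    _ = _ := lintegral_const_mul _ (hv.pow_const 2)

lemma lintegral_hardy {v : ℝ → ℝ≥0∞} (hv : AEMeasurable v (volume.restrict (Ioo (0 : ℝ) 1))) :
    ∫⁻ t in Ioo (0 : ℝ) 1, (∫⁻ s in Ioo 0 t, v s * ENNReal.ofReal ((omega s ^ 2)⁻¹)) ^ 2
      ≤ 2 * ∫⁻ s in Ioo (0 : ℝ) 1, v s ^ 2 := by
  calc _ = _ := ?_
    _ ≤ _ := lintegral_hardy_of_measurable hv.measurable_mk
    _ = _ := ?_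
  · refine setLIntegral_congr_fun measurableSet_Ioo fun t ht => ?_
    congr 1
    apply lintegral_congr_ae
    filter_upwards [ae_restrict_of_ae_restrict_of_subset (Ioo_subset_Ioo_right ht.2.le)
      hv.ae_eq_mk] with s hs
    rw [hs]
  · congr 1
    apply lintegral_congr_ae
    filter_upwards [hv.ae_eq_mk] with s hs
    rw [hs]

/-- Since `ω` decreases on `[0, 1)`, the factor `ω(t)^a` is at most `ω(s)^a` for `s ≤ t` and can be
moved inside the integral. With `v = |ω^{a+2} w|` the integrand becomes `v ω⁻²`, the form handled by
`lintegral_hardy`. -/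
lemma lintegral_primitive_lt_top (a : ℕ) {w : ℝ → ℝ}
    (hm : AEMeasurable w (volume.restrict (Ioo (0 : ℝ) 1)))
    (hw : ∫⁻ t in Ioo (0 : ℝ) 1, ‖omega t ^ (a + 2) * w t‖ₑ ^ 2 < ⊤) :
    ∫⁻ t in Ioo (0 : ℝ) 1, ‖omega t ^ a * ∫ s in (0 : ℝ)..t, w s‖ₑ ^ 2 < ⊤ := by
  have hvm : AEMeasurable (fun t => ‖omega t ^ (a + 2) * w t‖ₑ)
      (volume.restrict (Ioo (0 : ℝ) 1)) :=
    (((continuous_omega.pow _).measurable.aemeasurable).mul hm).enorm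
  refine lt_of_le_of_lt ?_ (ENNReal.mul_lt_top (ENNReal.ofNat_lt_top (n := 2)) hw)
  refine le_trans ?_ (lintegral_hardy hvm)
  refine setLIntegral_mono' measurableSet_Ioo fun t ht => ?_
  gcongr
  rw [intervalIntegral.integral_of_le ht.1.le, integral_Ioc_eq_integral_Ioo,
    ← integral_const_mul]
  refine (enorm_integral_le_lintegral_enorm _).trans ?_
  refine setLIntegral_mono' measurableSet_Ioo fun s hs => ?_
  have hpos := omega_pos (t := s) ⟨by linarith [hs.1], hs.2.trans ht.2⟩
  have hle := pow_le_pow_left₀ (omega_nonneg t) (omega_le_omega hs.1.le hs.2.le) a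
  rw [← Real.enorm_of_nonneg (r := (omega s ^ 2)⁻¹) (by positivity), ← enorm_mul]
  have e : omega s ^ (a + 2) * w s * (omega s ^ 2)⁻¹ = omega s ^ a * w s := by
    rw [pow_add]; field_simp
  rw [e, enorm_mul, enorm_mul]
  gcongr
  rw [Real.enorm_of_nonneg (pow_nonneg (omega_nonneg t) a),
    Real.enorm_of_nonneg (pow_nonneg hpos.le a)]
  exact ENNReal.ofReal_le_ofReal hle

lemma memLp_two_iff {f : ℝ → ℝ} (hf : AEStronglyMeasurable f mu) :
    MemLp f 2 mu ↔ ∫⁻ t in Ioo (-1 : ℝ) 1, ‖f t‖ₑ ^ 2 < ⊤ := by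
  have h := eLpNorm_lt_top_iff_lintegral_rpow_enorm_lt_top (f := f) (μ := mu) (p := 2)
    (by norm_num) (by norm_num)
  simp only [ENNReal.toReal_ofNat, ENNReal.rpow_ofNat] at h
  rw [← h]
  exact ⟨fun h => h.2, fun h => ⟨hf, h⟩⟩

lemma setLIntegral_Ioo_neg (F : ℝ → ℝ≥0∞) :
    ∫⁻ t in Ioo (-1 : ℝ) 0, F t = ∫⁻ t in Ioo (0 : ℝ) 1, F (-t) := by
  have h := (Measure.measurePreserving_neg (volume : Measure ℝ)).setLIntegral_comp_preimage_emb
    (MeasurableEquiv.neg ℝ).measurableEmbedding F (Ioo (-1 : ℝ) 0)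
  rw [← h]
  simp

lemma memLp_mul_of_bound {f p : ℝ → ℝ} (hf : MemLp f 2 mu) (hp : Continuous p) {C : ℝ}
    (hC : ∀ t ∈ Ioo (-1 : ℝ) 1, |p t| ≤ C) : MemLp (fun t => p t * f t) 2 mu := by
  refine (hf.const_mul C).mono (hp.aestronglyMeasurable.mul hf.1) ?_
  filter_upwards [ae_restrict_mem measurableSet_Ioo] with t ht
  rw [norm_mul, norm_mul]
  gcongr
  exact (hC t ht).trans (le_abs_self C)

lemma memLp_omega_mul {f : ℝ → ℝ} {a b : ℕ} (hab : a ≤ b)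
    (hf : MemLp (fun t => omega t ^ a * f t) 2 mu) : MemLp (fun t => omega t ^ b * f t) 2 mu := by
  obtain ⟨c, rfl⟩ := Nat.exists_eq_add_of_le hab
  have := memLp_mul_of_bound hf (p := fun t => omega t ^ c) (continuous_omega.pow c) (C := 1) (fun t _ => by
    rw [abs_of_nonneg (pow_nonneg (omega_nonneg t) c)]
    exact pow_le_one₀ (omega_nonneg t) (omega_le_one t))
  convert this using 2 with t
  ring

/-- Hardy's inequality: a primitive of `w` gains two powers of the weight over `w`. -/
theorem memLp_of_primitive (a : ℕ) {w h : ℝ → ℝ} {c : ℝ}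
    (hl : LocallyIntegrableOn w (Ioo (-1 : ℝ) 1))
    (hh : ∀ t ∈ Ioo (-1 : ℝ) 1, h t = c + ∫ s in (0 : ℝ)..t, w s)
    (hw : MemLp (fun t => omega t ^ (a + 2) * w t) 2 mu) :
    MemLp (fun t => omega t ^ a * h t) 2 mu := by
  have hwm : AEMeasurable w mu := hl.aestronglyMeasurable.aemeasurable
  have hlt := (memLp_two_iff hw.1).1 hw
  have hsub1 : Ioo (0 : ℝ) 1 ⊆ Ioo (-1 : ℝ) 1 := Ioo_subset_Ioo_left (by norm_num)
  have hsub2 : Ioo (-1 : ℝ) 0 ⊆ Ioo (-1 : ℝ) 1 := Ioo_subset_Ioo_right (by norm_num)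
  have hpm : AEStronglyMeasurable (fun t => omega t ^ a * ∫ s in (0 : ℝ)..t, w s) mu := by
    have := continuousOn_of_primitive (W := fun t => 0 + ∫ s in (0 : ℝ)..t, w s) hl
      (fun _ _ => rfl)
    simp only [zero_add] at this
    exact (continuous_omega.pow a).aestronglyMeasurable.mul
      (this.aestronglyMeasurable measurableSet_Ioo)
  have hprim : MemLp (fun t => omega t ^ a * ∫ s in (0 : ℝ)..t, w s) 2 mu := by
    rw [memLp_two_iff hpm]
    have h1 := lintegral_primitive_lt_top a
      (hwm.mono_measure (Measure.restrict_mono hsub1 le_rfl))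
      ((lintegral_mono_set hsub1).trans_lt hlt)
    -- The half `(-1, 0)` reduces to `(0, 1)` by the reflection `t ↦ -t`, under which `ω` is even.
    have hwneg : AEMeasurable (fun t => w (-t)) (volume.restrict (Ioo (0 : ℝ) 1)) := by
      have hmp := (Measure.measurePreserving_neg (volume : Measure ℝ)).restrict_preimage
        (measurableSet_Ioo (a := (-1 : ℝ)) (b := 0))
      have hpre : Neg.neg ⁻¹' Ioo (-1 : ℝ) 0 = Ioo 0 1 := by simp
      rw [hpre] at hmp
      exact (hwm.mono_measure (Measure.restrict_mono hsub2 le_rfl)).comp_quasiMeasurePreserving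
        hmp.quasiMeasurePreserving
    have h2 := lintegral_primitive_lt_top a hwneg (by
      have := (lintegral_mono_set hsub2).trans_lt hlt
      rw [setLIntegral_Ioo_neg] at this
      simpa only [omega_neg] using this)
    have e2 : ∫⁻ t in Ioo (-1 : ℝ) 0, ‖omega t ^ a * ∫ s in (0 : ℝ)..t, w s‖ₑ ^ 2
        = ∫⁻ t in Ioo (0 : ℝ) 1, ‖omega t ^ a * ∫ s in (0 : ℝ)..t, w (-s)‖ₑ ^ 2 := by
      rw [setLIntegral_Ioo_neg]
      apply lintegral_congr
      intro t
      have e : ∫ s in (0 : ℝ)..(-t), w s = -∫ s in (0 : ℝ)..t, w (-s) := by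
        rw [intervalIntegral.integral_comp_neg, neg_zero, intervalIntegral.integral_symm]
      rw [omega_neg, e, mul_neg, enorm_neg]
    have hcov : Ioo (-1 : ℝ) 1 ⊆ Ioc (-1 : ℝ) 0 ∪ Ico (0 : ℝ) 1 := fun t ht =>
      (le_total t 0).imp (fun h => ⟨ht.1, h⟩) fun h => ⟨h, ht.2⟩
    refine (lintegral_mono_set hcov).trans_lt ((lintegral_union_le _ _ _).trans_lt ?_)
    rw [setLIntegral_congr Ioo_ae_eq_Ioc.symm, setLIntegral_congr Ioo_ae_eq_Ico.symm, e2]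
    exact ENNReal.add_lt_top.2 ⟨h2, h1⟩
  have hconst : MemLp (fun t => omega t ^ a * c) 2 mu := by
    refine memLp_omega_mul (a := 0) (Nat.zero_le a) ?_
    simpa using memLp_const c
  refine (memLp_congr_ae ?_).1 (hconst.add hprim)
  filter_upwards [ae_restrict_mem measurableSet_Ioo] with t ht
  simp only [Pi.add_apply]
  rw [hh t ht, mul_add]

/-! ### The inclusion -/

/-- The leading term is the hypothesis, because `1 - t² = ω²`. One use of Hardy bounds the term in
`g (k - 1)`, a second one the term in `g (k - 2)`. -/
lemma memLp_leibniz {m k : ℕ} {g : ℕ → ℝ → ℝ}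
    (hg : ∀ j < k, HasWeakDeriv 1 (g j) (g (j + 1)) ∧
      ∃ c : ℝ, ∀ t ∈ Ioo (-1 : ℝ) 1, g j t = c + ∫ s in (0 : ℝ)..t, g (j + 1) s)
    (hk : MemLp (fun t => omega t ^ (m + 2 + k) * g k t) 2 mu) :
    MemLp (fun t => omega t ^ (m + k) * leibniz g k t) 2 mu := by
  have hlow : ∀ j < k, ∀ a, MemLp (fun t => omega t ^ (a + 2) * g (j + 1) t) 2 mu →
      MemLp (fun t => omega t ^ a * g j t) 2 mu := fun j hj a h => by
    obtain ⟨hd, c, hc⟩ := hg j hj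
    exact memLp_of_primitive a hd.locInt_right hc h
  have m1 : MemLp (fun t => omega t ^ (m + k) * ((1 - t ^ 2) * g k t)) 2 mu := by
    refine (memLp_congr_ae ?_).1 hk
    filter_upwards [ae_restrict_mem measurableSet_Ioo] with t ht
    rw [← omega_sq ht]
    ring
  have m2 : MemLp (fun t => (-2 * k * t) * (omega t ^ (m + k) * g (k - 1) t)) 2 mu := by
    rcases k with _ | k
    · simp
    · refine memLp_mul_of_bound (hlow k (by omega) _ ?_) (by fun_prop)
        (C := 2 * ((k + 1 : ℕ) : ℝ)) fun t ht => ?_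
      · convert hk using 3; ring
      · rw [abs_mul, abs_mul, abs_neg, abs_two, Nat.abs_cast]
        exact mul_le_of_le_one_right (by positivity) (abs_lt.2 ht).le
  have m3 : MemLp (fun t => (-(k * (k - 1)) : ℝ) * (omega t ^ (m + k) * g (k - 2) t)) 2 mu := by
    rcases k with _ | _ | k
    · simp
    · simp
    · have h1 : MemLp (fun t => omega t ^ (m + (k + 1 + 1)) * g (k + 1) t) 2 mu :=
        hlow (k + 1) (by omega) _ (by convert hk using 3; ring)
      -- The second use of Hardy has room to spare: the weight on `g (k + 1)` is first raised by two
      -- powers, since `ω ≤ 1`.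
      exact (hlow k (by omega) _ (memLp_omega_mul (by omega) h1)).const_mul _
  convert (m1.add m2).add m3 using 1
  funext t
  simp only [leibniz, Pi.add_apply]
  ring

/-- Elements of `X_{m+2}^k` have a weighted derivative of the kind that defines `X_m^k`. -/
theorem IsWDeriv.exists_lower {m k : ℕ} {u w : ℝ → ℝ} (h : IsWDeriv (m + 2) k u w) :
    ∃ w' : ℝ → ℝ, IsWDeriv m k u w' := by
  obtain ⟨g, hg0, hgk, hg⟩ := h.weak.exists_chain
  refine ⟨leibniz g k, ?_, memLp_leibniz hg (by rw [hgk]; exact h.memLp)⟩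
  refine (hasWeakDeriv_leibniz (LocallyIntegrableOn.congr hg0 h.weak.locInt_left)
    (fun j hj => (hg j hj).1) k le_rfl).congr_left ?_
  filter_upwards [hg0, ae_restrict_mem measurableSet_Ioo] with t ht hm
  have hpos := omega_pos hm
  rw [← ht, ← omega_sq hm, ← mul_assoc, ← zpow_natCast (omega t) 2, ← zpow_add₀ hpos.ne']
  congr 2
  push_cast
  ring

theorem XSub_add_two_le (m k : ℕ) : XSub (m + 2) k ≤ XSub m k :=
  fun _ ⟨_, hw⟩ => hw.exists_lower

/-! ### Completeness and continuity -/

variable {m k : ℕ}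

lemma X.isometry_graph : Isometry (X.graph : X m k →ₗ[ℝ] WithLp 2 (L2 × L2)) :=
  AddMonoidHomClass.isometry_of_norm _ fun _ => rfl

lemma X.continuous_toL2 : Continuous (X.toL2 : X m k →ₗ[ℝ] L2) :=
  (continuous_snd.comp (WithLp.prod_continuous_ofLp 2 L2 L2)).comp X.isometry_graph.continuous

/-- Testing against a compactly supported function is continuous on `L²(-1,1)`. -/
lemma exists_integral_functional {q ψ : ℝ → ℝ} (hq : ContinuousOn q (Ioo (-1 : ℝ) 1))
    (hψ : Continuous ψ) (hc : HasCompactSupport ψ) (hs : tsupport ψ ⊆ Ioo (-1 : ℝ) 1) :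
    ∃ A : L2 →L[ℝ] ℝ, ∀ f : L2, A f = ∫ t in Ioo (-1 : ℝ) 1, q t * f t * ψ t := by
  have hcont : Continuous (fun t => q t * ψ t) :=
    (hq.mul hψ.continuousOn).continuous_of_tsupport_subset isOpen_Ioo
      (tsupport_mul_subset_right.trans hs)
  have hmem : MemLp (fun t => q t * ψ t) 2 mu := hcont.memLp_of_hasCompactSupport hc.mul_left
  refine ⟨innerSL ℝ (hmem.toLp _), fun f => ?_⟩
  rw [innerSL_apply_apply, L2.inner_def]
  apply integral_congr_ae
  filter_upwards [hmem.coeFn_toLp] with t ht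
  rw [ht]
  simp only [RCLike.inner_apply, conj_trivial]
  ring

lemma locInt_of_L2 (f : L2) : LocallyIntegrableOn f (Ioo (-1 : ℝ) 1) :=
  IntegrableOn.locallyIntegrableOn (μ := volume) ((Lp.memLp f).integrable (by norm_num))

/-- Membership in the graph is expressed by equations linear in the pair `(v, u)`, one per test
function. Negative powers of `ω` cause no trouble, being continuous on the open interval. -/
lemma isWDeriv_of_integral_eq {u v : L2}
    (h : ∀ φ : ℝ → ℝ, ContDiff ℝ ∞ φ → HasCompactSupport φ → tsupport φ ⊆ Ioo (-1 : ℝ) 1 →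
      ∫ t in Ioo (-1 : ℝ) 1, omega t ^ (-(m : ℤ)) * u t * iteratedDeriv k φ t
        = (-1 : ℝ) ^ k * ∫ t in Ioo (-1 : ℝ) 1, omega t ^ (-((m + k : ℕ) : ℤ)) * v t * φ t) :
    IsWDeriv m k u (fun t => omega t ^ (-((m + k : ℕ) : ℤ)) * v t) := by
  have hc : ∀ n : ℤ, ContinuousOn (fun t => omega t ^ n) (Ioo (-1 : ℝ) 1) := fun n =>
    continuous_omega.continuousOn.zpow₀ n fun t ht => Or.inl (omega_pos ht).ne'
  refine ⟨⟨locInt_mul_continuous (locInt_of_L2 u) (hc _),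
    locInt_mul_continuous (locInt_of_L2 v) (hc _), h⟩, (memLp_congr_ae ?_).1 (Lp.memLp v)⟩
  filter_upwards [ae_restrict_mem measurableSet_Ioo] with t ht
  rw [← mul_assoc, ← zpow_natCast (omega t), ← zpow_add₀ (omega_pos ht).ne', add_neg_cancel,
    zpow_zero, one_mul]

lemma X.integral_eq (u : X m k) {φ : ℝ → ℝ} (h1 : ContDiff ℝ ∞ φ) (h2 : HasCompactSupport φ)
    (h3 : tsupport φ ⊆ Ioo (-1 : ℝ) 1) :
    ∫ t in Ioo (-1 : ℝ) 1, omega t ^ (-(m : ℤ)) * X.toL2 u t * iteratedDeriv k φ t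
      = (-1 : ℝ) ^ k *
        ∫ t in Ioo (-1 : ℝ) 1, omega t ^ (-((m + k : ℕ) : ℤ)) * X.weightedDeriv u t * φ t := by
  rw [u.isWDeriv.weak.integral_eq φ h1 h2 h3]
  congr 1
  apply integral_congr_ae
  have h4 : X.weightedDeriv u =ᵐ[mu] fun t => omega t ^ (m + k) * u.deriv t :=
    MemLp.coeFn_toLp u.isWDeriv.memLp
  filter_upwards [h4, ae_restrict_mem measurableSet_Ioo] with t ht hm
  rw [ht, ← mul_assoc, ← zpow_natCast (omega t), ← zpow_add₀ (omega_pos hm).ne', neg_add_cancel,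
    zpow_zero, one_mul]

lemma X.mem_range_graph {z : WithLp 2 (L2 × L2)}
    (hz : IsWDeriv m k z.snd (fun t => omega t ^ (-((m + k : ℕ) : ℤ)) * z.fst t)) :
    z ∈ range (X.graph : X m k →ₗ[ℝ] WithLp 2 (L2 × L2)) := by
  let u : X m k := ⟨z.snd, _, hz⟩
  refine ⟨u, ?_⟩
  have hfst : X.weightedDeriv u = z.fst := by
    apply Lp.ext
    have h4 : X.weightedDeriv u =ᵐ[mu] fun t => omega t ^ (m + k) * u.deriv t :=
      MemLp.coeFn_toLp u.isWDeriv.memLp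
    filter_upwards [h4, u.deriv_ae_eq hz, ae_restrict_mem measurableSet_Ioo] with t ht ht' hm
    rw [ht, ht', ← mul_assoc, ← zpow_natCast (omega t), ← zpow_add₀ (omega_pos hm).ne',
      add_neg_cancel, zpow_zero, one_mul]
  exact WithLp.ofLp_injective 2 (Prod.ext hfst rfl)

/-- On the compact support of a test function all powers of `ω` are bounded, so both sides of each
defining equation are continuous functionals on `L²`. The equations therefore pass to the closure.
-/
lemma X.isClosed_range_graph :
    IsClosed (range (X.graph : X m k →ₗ[ℝ] WithLp 2 (L2 × L2))) := by
  have hc : ∀ n : ℤ, ContinuousOn (fun t => omega t ^ n) (Ioo (-1 : ℝ) 1) := fun n =>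
    continuous_omega.continuousOn.zpow₀ n fun t ht => Or.inl (omega_pos ht).ne'
  refine isClosed_of_closure_subset fun z hz => ?_
  refine X.mem_range_graph (isWDeriv_of_integral_eq fun φ h1 h2 h3 => ?_)
  have hsub := tsupport_iteratedDeriv_subset k φ
  obtain ⟨A, hA⟩ := exists_integral_functional (hc (-(m : ℤ)))
    (contDiff_iteratedDeriv h1 k).continuous
    (h2.of_isClosed_subset (isClosed_tsupport _) hsub) (hsub.trans h3)
  obtain ⟨B, hB⟩ := exists_integral_functional (hc (-((m + k : ℕ) : ℤ))) h1.continuous h2 h3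
  have hcl : IsClosed {y : WithLp 2 (L2 × L2) | A y.snd = (-1 : ℝ) ^ k * B y.fst} := by
    have hofLp := WithLp.prod_continuous_ofLp 2 L2 L2
    exact isClosed_eq (A.continuous.comp (continuous_snd.comp hofLp))
      (continuous_const.mul (B.continuous.comp (continuous_fst.comp hofLp)))
  rw [← hA, ← hB]
  refine closure_minimal ?_ hcl hz
  rintro _ ⟨u, rfl⟩
  rw [mem_ofPred_eq, hA, hB]
  exact u.integral_eq h1 h2 h3

instance : CompleteSpace (X m k) :=
  (completeSpace_iff_isComplete_range X.isometry_graph.isUniformInducing).2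
    X.isClosed_range_graph.isComplete

/-- Every inclusion between these spaces is continuous, by the closed graph theorem. -/
theorem X.continuous_incl {m' k' : ℕ} (h : XSub m k ≤ XSub m' k') : Continuous (X.incl h) := by
  -- Both limits are compared in `L²`, where the inclusion acts as the identity.
  refine LinearMap.continuous_of_seq_closed_graph _ fun u x y hu hy => X.toL2_injective ?_
  have h1 := (X.continuous_toL2.tendsto y).comp hy
  have h2 := (X.continuous_toL2.tendsto x).comp hu
  exact tendsto_nhds_unique h1 h2

lemma X.incl_injective {m' k' : ℕ} (h : XSub m k ≤ XSub m' k') :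
    Function.Injective (X.incl h) :=
  Submodule.inclusion_injective h

/-! ### Strictness -/

lemma hasWeakDeriv_one_of_hasDerivAt {F f : ℝ → ℝ} (hf : ContinuousOn f (Ioo (-1 : ℝ) 1))
    (hF : ∀ t ∈ Ioo (-1 : ℝ) 1, HasDerivAt F (f t) t) : HasWeakDeriv 1 F f := by
  refine hasWeakDeriv_one_of_primitive (c := F 0) (hf.locallyIntegrableOn measurableSet_Ioo)
    fun t ht => ?_
  have hsub := uIcc_subset_Ioo (a := 0) (b := t) (by norm_num) ht
  rw [intervalIntegral.integral_eq_sub_of_hasDerivAt (fun s hs => hF s (hsub hs))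
    (hf.mono hsub).intervalIntegrable]
  ring

lemma exists_hasWeakDeriv_one_add (k : ℕ) :
    ∃ d : ℝ, HasWeakDeriv (k + 1) (fun t => 1 + t) (fun _ => d) := by
  induction k with
  | zero =>
    exact ⟨1, hasWeakDeriv_one_of_hasDerivAt continuousOn_const fun t _ =>
      (hasDerivAt_id t).const_add 1⟩
  | succ k ih =>
    obtain ⟨d, hd⟩ := ih
    exact ⟨0, hd.trans (hasWeakDeriv_one_of_hasDerivAt continuousOn_const fun t _ =>
      hasDerivAt_const t d)⟩

lemma hasWeakDeriv_one_sub_inv (k : ℕ) :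
    HasWeakDeriv k (fun t => (1 - t)⁻¹) (fun t => k.factorial * ((1 - t) ^ (k + 1))⁻¹) := by
  have hcont : ∀ n : ℕ, ContinuousOn (fun t : ℝ => (n.factorial : ℝ) * ((1 - t) ^ (n + 1))⁻¹)
      (Ioo (-1 : ℝ) 1) := fun n => by
    refine continuousOn_const.mul (ContinuousOn.inv₀ (by fun_prop) fun t ht => ?_)
    have : 0 < 1 - t := by linarith [ht.2]
    positivity
  induction k with
  | zero =>
    have := (hcont 0).locallyIntegrableOn (μ := volume) measurableSet_Ioo
    simpa using HasWeakDeriv.refl this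
  | succ k ih =>
    refine ih.trans (hasWeakDeriv_one_of_hasDerivAt (hcont (k + 1)) fun t ht => ?_)
    have hpos : 0 < 1 - t := by linarith [ht.2]
    have h1 : HasDerivAt (fun t : ℝ => 1 - t) (-1) t := by
      simpa using (hasDerivAt_id t).const_sub 1
    have h2 := ((h1.pow (k + 1)).inv (pow_ne_zero _ hpos.ne')).const_mul (k.factorial : ℝ)
    have e : ((k + 1).factorial : ℝ) * ((1 - t) ^ (k + 1 + 1))⁻¹
        = k.factorial * (-(((k + 1 : ℕ) : ℝ) * (1 - t) ^ (k + 1 - 1) * -1)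
          / ((1 - t) ^ (k + 1)) ^ 2) := by
      rw [Nat.factorial_succ, Nat.add_sub_cancel]
      push_cast
      field_simp
      ring
    rw [e]
    exact h2

/-- On `(0, 1)` one has `ω² ≥ 1 - t`, so the squared function dominates `(1 - t)⁻¹`, which is not
integrable up to `1`. -/
lemma not_memLp_singular {m k : ℕ} (hmk : m < k) :
    ¬ MemLp (fun t => omega t ^ (m + 2 + k) * (k.factorial * ((1 - t) ^ (k + 1))⁻¹)) 2 mu := by
  intro h
  have h1 : IntegrableOn (fun t => (omega t ^ (m + 2 + k) *
      (k.factorial * ((1 - t) ^ (k + 1))⁻¹)) ^ 2) (Ioo (0 : ℝ) 1) :=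
    IntegrableOn.mono_set (t := Ioo (-1 : ℝ) 1) h.integrable_sq (Ioo_subset_Ioo_left (by norm_num))
  have h2 : IntegrableOn (fun t : ℝ => (t - 1)⁻¹) (Ioo (0 : ℝ) 1) := by
    refine Integrable.mono h1 (by fun_prop) ?_
    filter_upwards [ae_restrict_mem measurableSet_Ioo] with t ht
    have hpos : 0 < 1 - t := by linarith [ht.2]
    have hle1 : 1 - t ≤ 1 := by linarith [ht.1]
    have hfac : (1 : ℝ) ≤ (k.factorial : ℝ) ^ 2 :=
      one_le_pow₀ (by exact_mod_cast k.factorial_pos)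
    have hω : 1 - t ≤ omega t ^ 2 := by
      rw [omega_sq ⟨by linarith [ht.1], ht.2⟩]
      nlinarith [ht.1, ht.2]
    rw [Real.norm_of_nonneg (sq_nonneg _), norm_inv, ← norm_neg, neg_sub,
      Real.norm_of_nonneg hpos.le]
    calc (1 - t)⁻¹ = (1 - t) ^ (2 * k + 1) * (((1 - t) ^ (k + 1))⁻¹) ^ 2 := by
          field_simp
          ring
      _ ≤ (1 - t) ^ (m + 2 + k) * (((1 - t) ^ (k + 1))⁻¹) ^ 2 := by
          gcongr ?_ * _
          -- The exponent condition `m + 2 + k ≤ 2k + 1` is exactly `m < k`.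
          exact pow_le_pow_of_le_one hpos.le hle1 (by omega)
      _ ≤ (omega t ^ 2) ^ (m + 2 + k) * ((k.factorial : ℝ) ^ 2 * (((1 - t) ^ (k + 1))⁻¹) ^ 2) := by
          gcongr
          exact le_mul_of_one_le_left (by positivity) hfac
      _ = _ := by ring
  have h3 : IntervalIntegrable (fun t : ℝ => (t - 1)⁻¹) volume 0 1 :=
    (intervalIntegrable_iff_integrableOn_Ioo_of_le zero_le_one).2 h2
  rw [intervalIntegrable_sub_inv_iff] at h3
  simp at h3

/-- The witness is `ω^m (1 + t)`. The factor `1 + t` cancels the zero of `ω² = (1 - t)(1 + t)` at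
`-1`, so dividing by `ω^{m+2}` leaves a single pole, at `1`. -/
theorem XSub_add_two_ne {m k : ℕ} (hmk : m < k) : XSub (m + 2) k ≠ XSub m k := by
  intro heq
  have hu : MemLp (fun t => omega t ^ m * (1 + t)) 2 mu := by
    refine memLp_omega_mul (a := 0) (Nat.zero_le m) ?_
    have := memLp_mul_of_bound (memLp_const (μ := mu) (p := 2) (1 : ℝ)) (p := fun t => 1 + t)
      (by fun_prop) (C := 2) (fun t ht => abs_le.2 ⟨by linarith [ht.1], by linarith [ht.2]⟩)
    simpa using this
  have hmem : hu.toLp _ ∈ XSub m k := by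
    obtain ⟨j, rfl⟩ := Nat.exists_eq_succ_of_ne_zero (by omega : k ≠ 0)
    obtain ⟨d, hd⟩ := exists_hasWeakDeriv_one_add j
    refine ⟨fun _ => d, ?_, memLp_omega_mul (a := 0) (Nat.zero_le _) (by simpa using memLp_const d)⟩
    refine hd.congr_left ?_
    filter_upwards [hu.coeFn_toLp, ae_restrict_mem measurableSet_Ioo] with t ht hm
    rw [ht, ← mul_assoc, ← zpow_natCast (omega t), ← zpow_add₀ (omega_pos hm).ne',
      neg_add_cancel, zpow_zero, one_mul]
  rw [← heq] at hmem
  obtain ⟨w, hw⟩ := hmem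
  have hD : HasWeakDeriv k (fun t => omega t ^ (-((m + 2 : ℕ) : ℤ)) * hu.toLp _ t)
      (fun t => k.factorial * ((1 - t) ^ (k + 1))⁻¹) := by
    refine (hasWeakDeriv_one_sub_inv k).congr_left ?_
    filter_upwards [hu.coeFn_toLp, ae_restrict_mem measurableSet_Ioo] with t ht hm
    have hpos := omega_pos hm
    have h1 : (1 - t) ≠ 0 := by linarith [hm.2]
    have hsq : omega t ^ 2 = (1 - t) * (1 + t) := by rw [omega_sq hm]; ring
    have h2 : (1 + t) ≠ 0 := by linarith [hm.1]
    rw [ht, zpow_neg, zpow_natCast, pow_add, hsq]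
    field_simp
  refine not_memLp_singular hmk ((memLp_congr_ae ?_).1 hw.memLp)
  filter_upwards [hw.weak.unique hD] with t ht
  rw [ht]

end WSob

theorem mainTheorem8 (m k : ℕ) :
    (∃ h : WSob.XSub (m + 2) k ≤ WSob.XSub m k,
      Continuous (WSob.X.incl h) ∧ Function.Injective (WSob.X.incl h)) ∧
    (m < k → WSob.XSub (m + 2) k < WSob.XSub m k) :=
  ⟨⟨WSob.XSub_add_two_le m k, WSob.X.continuous_incl _, WSob.X.incl_injective _⟩,
    fun hmk => (WSob.XSub_add_two_le m k).lt_of_ne (WSob.XSub_add_two_ne hmk)⟩
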